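/- Let $X$ be a collectionwise normal Hausdorff space (every discrete collection of subsets of $X$ has an open discrete expansion), let $E$ be a Banach space, and let $\Phi$ assign to each $x\in X$ a nonempty closed convex set $\Phi(x)\subset E$. Suppose $\Phi$ is lower semi-continuous (l.s.c.), i.e. $\{x\in X:\Phi(x)\cap U\neq\emptyset\}$ is open in $X$ for every open $U\subset E$. Let $A\subset X$ be a closed subset such that the restriction $\Phi{\upharpoonright}(X\setminus A)$ is proximal continuous: it is l.s.c. and there is a metric $d$ on $E$, inducing the norm topology of $E$, such that for every $\varepsilon>0$ each point $p\in X\setminus A$ has a neighbourhood $V$ in $X\setminus A$ with $$\Phi(x)\subset\{y\in E: d(y,z)<\varepsilon\text{ for some }z\in\Phi(p)\}\quad\text{for all }x\in V.$$ Then every continuous map $g:A\to E$ with $g(x)\in\Phi(x)$ for all $x\in A$ can be extended to a continuous map $f:X\to E$ with $f(x)\in\Phi(x)$ for all $x\in X$. -/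

import Mathlib

open Topology

/-- An indexed family of subsets is *discrete* if every point has a neighbourhood meeting at most
one member of the family (members being counted by their index). -/
def IsDiscreteFamily {X ι : Type*} [TopologicalSpace X] (s : ι → Set X) : Prop :=
  ∀ x : X, ∃ N ∈ 𝓝 x, {i : ι | (s i ∩ N).Nonempty}.Subsingleton

/-- Collectionwise normality (Bing): every discrete collection of subsets has an open discrete
expansion. The Hausdorff axiom is a separate hypothesis. -/
def CollectionwiseNormal (X : Type*) [TopologicalSpace X] : Prop :=
  ∀ 𝒟 : Set (Set X), IsDiscreteFamily (fun D : 𝒟 => (D : Set X)) →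
    ∃ U : 𝒟 → Set X, (∀ D : 𝒟, IsOpen (U D)) ∧ (∀ D : 𝒟, (D : Set X) ⊆ U D) ∧ IsDiscreteFamily U

/-- `ρ`-upper semi-continuity of a set-valued mapping into a metric space `(Y, ρ)`: for every
`ε > 0`, each point `p` has a neighbourhood on which `Φ x` lies in the open `ε`-neighbourhood
of `Φ p`. -/
def SetValuedMetricUSC {X Y : Type*} [TopologicalSpace X] [MetricSpace Y] (Φ : X → Set Y) : Prop :=
  ∀ ε : ℝ, 0 < ε → ∀ p : X, ∃ V ∈ 𝓝 p, ∀ x ∈ V, Φ x ⊆ Metric.thickening ε (Φ p)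

/-- Proximal continuity of a set-valued mapping into a (metrizable) space `Y`: it is l.s.c.
(that is, lower hemicontinuous), and it is `d`-u.s.c. for some metric `d` on `Y` that induces the
given topology of `Y`. -/
def ProximalContinuous {X Y : Type*} [TopologicalSpace X] [tY : TopologicalSpace Y]
    (Φ : X → Set Y) : Prop :=
  LowerHemicontinuous Φ ∧ ∃ d : MetricSpace Y,
    d.toPseudoMetricSpace.toUniformSpace.toTopologicalSpace = tY ∧
      @SetValuedMetricUSC X Y _ d Φ

/-! By Dowker's theorem `g` extends to a continuous `φ : X → E`, in general not a selection. Lower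
semi-continuity gives a continuous `η ≥ 0`, zero on `A`, that dominates the distance from `φ` to `Φ`
truncated at 1. Where `η = 0`, closedness puts `φ x` in `Φ x`. Where `η ≠ 0`, a set disjoint from
`A`, `Φ` is proximal continuous and has a continuous selection whose distance to `φ` is at most `6 *
η` once `η < 1/2`; hence it glues continuously to `φ`.

No paracompactness of `X \ A` is available for that selection. It is replaced by
`ProximalContinuous.exists_partition`: for uniformly Lipschitz functions on the range space, the
suprema over `Φ y` and over any subfamily are continuous in `y` (from below by lower
semi-continuity, from above by metric upper semi-continuity). Continuity of all subfamily suprema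
yields locally finite partitions of unity on an arbitrary space, after which Michael's successive
approximations apply. The same refinement principle, pulled back from `E`, drives the proof of
Dowker's theorem. -/

/-! ### Discrete refinements and partitions of unity from continuous suprema -/

theorem IsDiscreteFamily.locallyFinite {X ι : Type*} [TopologicalSpace X] {s : ι → Set X}
    (hs : IsDiscreteFamily s) : LocallyFinite s := by
  intro x
  obtain ⟨N, hN, h⟩ := hs x
  exact ⟨N, hN, h.finite⟩

theorem IsDiscreteFamily.subsingleton {X ι : Type*} [TopologicalSpace X] {s : ι → Set X}
    (hs : IsDiscreteFamily s) (x : X) : {i | x ∈ s i}.Subsingleton := by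
  obtain ⟨N, hN, h⟩ := hs x
  exact h.anti fun i hi => ⟨x, hi, mem_of_mem_nhds hN⟩

/-- If all suprema of subfamilies of a family of functions with values in `[0, 1]` are continuous,
then the cozero cover of the family has a `σ`-discrete refinement by cozero sets. -/
theorem exists_sigmaDiscrete_refinement {Y ι : Type*} [TopologicalSpace Y] (f : ι → Y → ℝ)
    (h1 : ∀ i y, f i y ≤ 1)
    (hc : ∀ J : Set ι, Continuous fun y => ⨆ i : J, f i y) (hpos : ∀ y, ∃ i, 0 < f i y) :
    ∃ k : ℕ → ι → Y → ℝ, (∀ n i, Continuous (k n i)) ∧ (∀ n i y, 0 ≤ k n i y) ∧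
      (∀ n i y, k n i y ≤ 1) ∧ (∀ n, IsDiscreteFamily fun i => Function.support (k n i)) ∧
      (∀ n i y, k n i y ≠ 0 → 0 < f i y) ∧ ∀ y, ∃ n i, 0 < k n i y := by
  obtain ⟨_, _⟩ := exists_wellFoundedLT ι
  have hbdd : ∀ (J : Set ι) y, BddAbove (Set.range fun i : J => f i y) := fun J y =>
    ⟨1, by rintro _ ⟨i, rfl⟩; exact h1 _ _⟩
  have hle : ∀ (J : Set ι) y i, i ∈ J → f i y ≤ ⨆ i : J, f i y := fun J y i hi =>
    le_ciSup (hbdd J y) ⟨i, hi⟩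
  have hfc : ∀ i, Continuous (f i) := fun i => by
    have := hc {i}
    simpa using this
  set g : ι → Y → ℝ := fun i y => ⨆ j : Set.Iio i, f j y with hg
  have hgc : ∀ i, Continuous (g i) := fun i => hc _
  set c : ℕ → ℝ := fun n => (1 / 2) ^ n with hcn
  have hc0 : ∀ n, 0 < c n := fun n => by positivity
  have hmem : ∀ n i y, max 0 (min (f i y - c n) (c n / 2 - g i y)) ≠ 0 →
      c n < f i y ∧ g i y < c n / 2 := by
    intro n i y h
    by_contra hcon
    apply h
    apply max_eq_left
    rw [not_and_or, not_lt, not_lt] at hcon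
    rcases hcon with h | h
    · exact (min_le_left _ _).trans (by linarith)
    · exact (min_le_right _ _).trans (by linarith)
  -- After well-ordering the indices, `i` is active at level `n` where `f i > c n` while all earlier
  -- functions stay below `c n / 2`. The gap between the two thresholds gives discreteness.
  refine ⟨fun n i y => max 0 (min (f i y - c n) (c n / 2 - g i y)), ?_, ?_, ?_, ?_, ?_, ?_⟩
  · intro n i
    have := hfc i
    have := hgc i
    fun_prop
  · intro n i y
    exact le_max_left _ _
  · intro n i y
    refine max_le zero_le_one ((min_le_left _ _).trans ?_)
    linarith [h1 i y, hc0 n]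
  · intro n p
    have hcn0 := hc0 n
    -- With `i₀` the least such index, near `p` the bound `f i₀ > c n / 2` excludes later indices
    -- and `g i₀ < c n` excludes earlier ones. If there is none, the total supremum is below `c n`
    -- near `p` and no index is active.
    by_cases hp : ∃ i, 3 / 4 * c n < f i p
    · let i₀ := WellFounded.min (wellFounded_lt (α := ι)) {i | 3 / 4 * c n < f i p} hp
      have hi₀ : 3 / 4 * c n < f i₀ p := WellFounded.min_mem _ _ hp
      have hmin : ∀ j < i₀, f j p ≤ 3 / 4 * c n := fun j hj =>
        not_lt.1 fun h => WellFounded.not_lt_min (wellFounded_lt (α := ι)) _ h hj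
      have hg₀ : g i₀ p < c n := by
        refine lt_of_le_of_lt (Real.iSup_le (fun j => hmin j j.2) (by linarith)) (by linarith)
      refine ⟨{y | c n / 2 < f i₀ y} ∩ {y | g i₀ y < c n}, ?_, ?_⟩
      · refine Filter.inter_mem ?_ ?_
        · exact (isOpen_lt continuous_const (hfc i₀)).mem_nhds (by
            change c n / 2 < f i₀ p; linarith)
        · exact (isOpen_lt (hgc i₀) continuous_const).mem_nhds hg₀
      · have key : ∀ j ∈ {j | (Function.support (fun y =>
            max 0 (min (f j y - c n) (c n / 2 - g j y))) ∩
            ({y | c n / 2 < f i₀ y} ∩ {y | g i₀ y < c n})).Nonempty}, j = i₀ := by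
          rintro j ⟨y, hy, hy1, hy2⟩
          obtain ⟨ha, hb⟩ := hmem n j y hy
          rcases lt_trichotomy j i₀ with h | h | h
          · have := hle (Set.Iio i₀) y j h
            change g i₀ y < c n at hy2
            change f j y ≤ g i₀ y at this
            linarith
          · exact h
          · have := hle (Set.Iio j) y i₀ h
            change c n / 2 < f i₀ y at hy1
            change f i₀ y ≤ g j y at this
            linarith
        intro a ha b hb
        rw [key a ha, key b hb]
    · push Not at hp
      refine ⟨{y | ⨆ i : (Set.univ : Set ι), f i y < c n}, ?_, ?_⟩
      · refine (isOpen_lt (hc _) continuous_const).mem_nhds ?_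
        have : ⨆ i : (Set.univ : Set ι), f i p ≤ 3 / 4 * c n :=
          Real.iSup_le (fun j => hp j) (by linarith)
        exact this.trans_lt (by linarith)
      · rintro a ⟨y, hy, hy2⟩
        obtain ⟨ha, hb⟩ := hmem n a y hy
        have := hle Set.univ y a trivial
        exact absurd (ha.trans_le this) (not_lt.2 (le_of_lt hy2))
  · intro n i y h
    exact (hc0 n).trans (hmem n i y h).1
  · intro y
    let i₀ := WellFounded.min (wellFounded_lt (α := ι)) {i | 0 < f i y} (hpos y)
    have hi₀ : 0 < f i₀ y := WellFounded.min_mem _ _ (hpos y)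
    have hmin : ∀ j < i₀, f j y ≤ 0 := fun j hj =>
      not_lt.1 fun h => WellFounded.not_lt_min (wellFounded_lt (α := ι)) _ h hj
    obtain ⟨n, hn⟩ := exists_pow_lt_of_lt_one hi₀ (by norm_num : (1 / 2 : ℝ) < 1)
    refine ⟨n, i₀, lt_max_of_lt_right (lt_min (sub_pos.2 hn) ?_)⟩
    have : g i₀ y ≤ 0 := Real.iSup_le (fun j => hmin j j.2) le_rfl
    linarith [hc0 n]

/-- Under the assumptions of `exists_sigmaDiscrete_refinement`, the cozero cover of the family has
a locally finite partition of unity. -/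
theorem exists_locallyFinite_partition {Y ι : Type*} [TopologicalSpace Y] (f : ι → Y → ℝ)
    (h1 : ∀ i y, f i y ≤ 1)
    (hc : ∀ J : Set ι, Continuous fun y => ⨆ i : J, f i y) (hpos : ∀ y, ∃ i, 0 < f i y) :
    ∃ p : ℕ × ι → Y → ℝ, (∀ i, Continuous (p i)) ∧ (∀ i y, 0 ≤ p i y) ∧
      (LocallyFinite fun i => Function.support (p i)) ∧ (∀ y, ∑ᶠ i, p i y = 1) ∧
      ∀ i y, p i y ≠ 0 → 0 < f i.2 y := by
  obtain ⟨k, kc, k0, k1, kd, kf, kpos⟩ := exists_sigmaDiscrete_refinement f h1 hc hpos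
  set s : ℕ → Y → ℝ := fun n y => ∑ᶠ i, k n i y with hs
  have sc : ∀ n, Continuous (s n) := fun n => continuous_finsum (kc n) (kd n).locallyFinite
  have s_eq : ∀ n i y, k n i y ≠ 0 → s n y = k n i y := fun n i y h =>
    finsum_eq_single _ i fun j hj => by
      by_contra hne
      exact hj ((kd n).subsingleton y hne h)
  have s0 : ∀ n y, 0 ≤ s n y := fun n y => finsum_nonneg fun i => k0 n i y
  have s1 : ∀ n y, s n y ≤ 1 := by
    intro n y
    by_cases h : ∃ i, k n i y ≠ 0
    · obtain ⟨i, hi⟩ := h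
      rw [s_eq n i y hi]
      exact k1 n i y
    · push Not at h
      simp [hs, h]
  -- Subtracting `n` times the earlier levels makes the levels locally finite: once some `s m` is
  -- bounded below near `y`, the subtracted term exceeds `1 ≥ s n` for large `n`. At the first level
  -- with `s n y > 0` nothing is lost.
  set t : ℕ → Y → ℝ := fun n y => max 0 (s n y - n * ∑ m ∈ Finset.range n, s m y) with ht
  have tc : ∀ n, Continuous (t n) := fun n => by
    have := sc n
    have := continuous_finsetSum (Finset.range n) fun m _ => sc m
    fun_prop
  have t0 : ∀ n y, 0 ≤ t n y := fun n y => le_max_left _ _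
  have hqlf : LocallyFinite fun i : ℕ × ι => Function.support fun y => t i.1 y * k i.1 i.2 y := by
    intro y
    obtain ⟨m, i, hmi⟩ := kpos y
    have hsm : 0 < s m y := by rw [s_eq m i y hmi.ne']; exact hmi
    obtain ⟨M, hM⟩ := exists_nat_gt (2 / s m y)
    choose N hN hNs using fun n => kd n y
    refine ⟨{x | s m y / 2 < s m x} ∩ ⋂ n ∈ Finset.range (max M (m + 1)), N n,
      Filter.inter_mem ((isOpen_lt continuous_const (sc m)).mem_nhds (half_lt_self hsm))
        ((Filter.biInter_finset_mem _).2 fun n _ => hN n), ?_⟩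
    refine ((Finset.range (max M (m + 1))).finite_toSet.biUnion (t := fun n =>
      Prod.mk n '' {i | (Function.support (k n i) ∩ N n).Nonempty}) fun n _ =>
        (hNs n).finite.image _).subset ?_
    rintro ⟨n, j⟩ ⟨x, hx, hx1, hx2⟩
    have hxt : t n x ≠ 0 := left_ne_zero_of_mul hx
    have hxk : k n j x ≠ 0 := right_ne_zero_of_mul hx
    have hn : n < max M (m + 1) := by
      by_contra hcon
      push Not at hcon
      apply hxt
      apply max_eq_left
      have hmn : m ∈ Finset.range n := Finset.mem_range.2 (by have := le_max_right M (m+1); omega)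
      have hle : s m x ≤ ∑ m ∈ Finset.range n, s m x :=
        Finset.single_le_sum (f := fun m => s m x) (fun j _ => s0 j x) hmn
      have hMn : (M : ℝ) ≤ n := by exact_mod_cast (le_max_left M (m + 1)).trans hcon
      have h2 : 2 < n * s m y := by
        rw [div_lt_iff₀ hsm] at hM
        nlinarith
      have h3 : (n : ℝ) * (s m y / 2) ≤ n * ∑ m ∈ Finset.range n, s m x :=
        mul_le_mul_of_nonneg_left ((le_of_lt hx1).trans hle) (Nat.cast_nonneg _)
      linarith [s1 n x]
    refine Set.mem_biUnion (x := n) (Finset.mem_range.2 hn) ⟨j, ⟨x, hxk, ?_⟩, rfl⟩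
    exact Set.mem_iInter₂.1 hx2 n (Finset.mem_range.2 hn)
  have qc : ∀ i : ℕ × ι, Continuous fun y => t i.1 y * k i.1 i.2 y := fun i =>
    (tc i.1).mul (kc i.1 i.2)
  have q0 : ∀ (i : ℕ × ι) y, 0 ≤ t i.1 y * k i.1 i.2 y := fun i y =>
    mul_nonneg (t0 _ _) (k0 _ _ _)
  set Q : Y → ℝ := fun y => ∑ᶠ i : ℕ × ι, t i.1 y * k i.1 i.2 y with hQ
  have Qc : Continuous Q := continuous_finsum qc hqlf
  have Qpos : ∀ y, 0 < Q y := by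
    intro y
    have hex : ∃ n, 0 < s n y := by
      obtain ⟨n, i, h⟩ := kpos y
      exact ⟨n, by rw [s_eq n i y h.ne']; exact h⟩
    classical
    have hn := Nat.find_spec hex
    have hmin : ∀ m < Nat.find hex, s m y = 0 := fun m hm =>
      le_antisymm (not_lt.1 (Nat.find_min hex hm)) (s0 m y)
    set n := Nat.find hex
    have htn : t n y = s n y := by
      simp only [ht]
      rw [Finset.sum_eq_zero fun m hm => hmin m (Finset.mem_range.1 hm)]
      simpa using hn.le
    obtain ⟨i, hi⟩ : ∃ i, k n i y ≠ 0 := by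
      by_contra hcon
      push Not at hcon
      simp [hs, hcon] at hn
    have hki : 0 < k n i y := lt_of_le_of_ne (k0 _ _ _) hi.symm
    refine finsum_pos (fun i => q0 i y) ⟨(n, i), ?_⟩ (hqlf.point_finite y)
    rw [htn]
    exact mul_pos hn hki
  refine ⟨fun i y => t i.1 y * k i.1 i.2 y / Q y, ?_, ?_, ?_, ?_, ?_⟩
  · exact fun i => (qc i).div Qc fun y => (Qpos y).ne'
  · exact fun i y => div_nonneg (q0 i y) (Qpos y).le
  · refine hqlf.subset fun i y hy => ?_
    exact (div_ne_zero_iff.1 hy).1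
  · intro y
    simp only [div_eq_mul_inv]
    rw [← finsum_mul]
    exact mul_inv_cancel₀ (Qpos y).ne'
  · intro i y hy
    exact kf i.1 i.2 y (right_ne_zero_of_mul (div_ne_zero_iff.1 hy).1)

/-! ### Partitions of unity from proximal continuity -/

theorem exists_lipschitz_pos_iff_mem {Z : Type*} [MetricSpace Z] {W : Set Z} (hW : IsOpen W) :
    ∃ u : Z → ℝ, (∀ z, 0 ≤ u z) ∧ (∀ z, u z ≤ 1) ∧ (∀ z z', u z ≤ u z' + dist z z') ∧
      ∀ z, 0 < u z ↔ z ∈ W := by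
  have hfin : ∀ z, min 1 (Metric.infEDist z Wᶜ) ≠ ⊤ := fun z =>
    ne_top_of_le_ne_top ENNReal.one_ne_top (min_le_left _ _)
  -- The extended distance is truncated before conversion to a real, so that `W = univ` gives the
  -- value 1; `infDist` to the empty set would be 0.
  refine ⟨fun z => (min 1 (Metric.infEDist z Wᶜ)).toReal, fun z => ENNReal.toReal_nonneg, ?_, ?_, ?_⟩
  · intro z
    exact ENNReal.toReal_mono ENNReal.one_ne_top (min_le_left _ _)
  · intro z z'
    rw [dist_edist, ← ENNReal.toReal_add (hfin z') (edist_ne_top _ _)]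
    refine ENNReal.toReal_mono (ENNReal.add_ne_top.2 ⟨hfin z', edist_ne_top _ _⟩) ?_
    rw [min_add]
    exact le_min ((min_le_left _ _).trans le_self_add)
      ((min_le_right _ _).trans Metric.infEDist_le_infEDist_add_edist)
  · intro z
    rw [ENNReal.toReal_pos_iff, and_iff_left (lt_top_iff_ne_top.2 (hfin z)), lt_min_iff,
      and_iff_right zero_lt_one, pos_iff_ne_zero, Ne, ← Metric.mem_closure_iff_infEDist_zero,
      hW.isClosed_compl.closure_eq, Set.notMem_compl_iff]

/-- The preimages of an open family that is met by all values of a proximal continuous mapping have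
a locally finite partition of unity, on any space. -/
theorem ProximalContinuous.exists_partition {Y Z ι : Type*} [TopologicalSpace Y]
    [TopologicalSpace Z] {Θ : Y → Set Z} (hΘ : ProximalContinuous Θ) (W : ι → Set Z)
    (hW : ∀ i, IsOpen (W i)) (hcov : ∀ y, ∃ i, (Θ y ∩ W i).Nonempty) :
    ∃ p : ℕ × ι → Y → ℝ, (∀ i, Continuous (p i)) ∧ (∀ i y, 0 ≤ p i y) ∧
      (LocallyFinite fun i => Function.support (p i)) ∧ (∀ y, ∑ᶠ i, p i y = 1) ∧
      ∀ i y, p i y ≠ 0 → (Θ y ∩ W i.2).Nonempty := by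
  obtain ⟨hl, d, rfl, hd⟩ := hΘ
  choose u u0 u1 ul uW using fun i => exists_lipschitz_pos_iff_mem (hW i)
  have uc : ∀ i, Continuous (u i) := fun i => by
    refine (LipschitzWith.of_le_add (f := u i) fun z z' => ul i z z').continuous
  have hbz : ∀ i y, BddAbove (Set.range fun z : Θ y => u i z) := fun i y =>
    ⟨1, by rintro _ ⟨z, rfl⟩; exact u1 _ _⟩
  have f0 : ∀ i y, 0 ≤ ⨆ z : Θ y, u i z := fun i y => Real.iSup_nonneg fun z => u0 _ _
  have f1 : ∀ i y, ⨆ z : Θ y, u i z ≤ 1 := fun i y => Real.iSup_le (fun z => u1 _ _) zero_le_one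
  have hle : ∀ i y, ∀ z ∈ Θ y, u i z ≤ ⨆ z : Θ y, u i z := fun i y z hz =>
    le_ciSup (hbz i y) ⟨z, hz⟩
  have hsup : ∀ J : Set ι, Continuous fun y => ⨆ i : J, ⨆ z : Θ y, u i z := by
    intro J
    set F : Y → ℝ := fun y => ⨆ i : J, ⨆ z : Θ y, u i z with hF
    have F0 : ∀ y, 0 ≤ F y := fun y => Real.iSup_nonneg fun i => f0 _ _
    have hFle : ∀ y, ∀ i ∈ J, ∀ z ∈ Θ y, u i z ≤ F y := fun y i hi z hz =>
      (hle i y z hz).trans (le_ciSup (f := fun i : J => ⨆ z : Θ y, u i z)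
        ⟨1, by rintro _ ⟨j, rfl⟩; exact f1 _ _⟩ ⟨i, hi⟩)
    have hFlt : ∀ y r, 0 ≤ r → r < F y → ∃ i ∈ J, ∃ z ∈ Θ y, r < u i z := by
      intro y r hr h
      by_contra! hcon
      exact h.not_ge (Real.iSup_le (fun i => Real.iSup_le (fun z => hcon i i.2 z z.2) hr) hr)
    rw [continuous_iff_continuousAt]
    intro y₀
    rw [ContinuousAt, tendsto_order]
    constructor
    · intro r hr
      rcases lt_or_ge r 0 with h | h
      · exact Filter.Eventually.of_forall fun y => h.trans_le (F0 y)
      obtain ⟨i, hi, z, hz, hrz⟩ := hFlt y₀ r h hr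
      have hopen := lowerHemicontinuous_iff_isOpen_inter_nonempty.1 hl _
        (isOpen_lt continuous_const (uc i) : IsOpen {z | r < u i z})
      filter_upwards [hopen.mem_nhds ⟨z, hz, hrz⟩] with y hy
      obtain ⟨z', hz', hr'⟩ := hy
      exact lt_of_lt_of_le hr' (hFle y i hi z' hz')
    · intro r hr
      -- If `F y ≥ r`, some `u i z` with `z ∈ Θ y` exceeds the midpoint of `F y₀` and `r`. Moving
      -- `z` into `Θ y₀` costs less than half the gap, the `u i` being 1-Lipschitz, and contradicts
      -- the definition of `F y₀`.
      obtain ⟨V, hV, hVs⟩ := hd ((r - F y₀) / 2) (by linarith) y₀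
      filter_upwards [hV] with y hy
      by_contra! hcon
      obtain ⟨i, hi, z, hz, hrz⟩ := hFlt y ((r + F y₀) / 2) (by linarith [F0 y₀]) (by linarith)
      obtain ⟨z', hz', hdz⟩ := Metric.mem_thickening_iff.1 (hVs y hy hz)
      linarith [hFle y₀ i hi z' hz', ul i z z']
  have hpos : ∀ y, ∃ i, 0 < ⨆ z : Θ y, u i z := by
    intro y
    obtain ⟨i, z, hz, hzW⟩ := hcov y
    exact ⟨i, ((uW i z).2 hzW).trans_le (hle i y z hz)⟩
  obtain ⟨p, pc, p0, plf, psum, pf⟩ := exists_locallyFinite_partition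
    (fun i y => ⨆ z : Θ y, u i z) f1 hsup hpos
  refine ⟨p, pc, p0, plf, psum, fun i y hi => ?_⟩
  by_contra hcon
  refine (pf i y hi).not_ge (Real.iSup_le (fun z => ?_) le_rfl)
  rw [← not_lt, uW]
  exact fun hz => hcon ⟨z, z.2, hz⟩

theorem ProximalContinuous.comp {X Y Z : Type*} [TopologicalSpace X] [TopologicalSpace Y]
    [TopologicalSpace Z] {Φ : Y → Set Z} (hΦ : ProximalContinuous Φ) {e : X → Y}
    (he : Continuous e) : ProximalContinuous fun x => Φ (e x) := by
  obtain ⟨hl, d, rfl, hd⟩ := hΦ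
  refine ⟨?_, d, rfl, ?_⟩
  · rw [lowerHemicontinuous_iff_isOpen_inter_nonempty] at hl ⊢
    exact fun u hu => (hl u hu).preimage he
  · intro ε hε x
    obtain ⟨V, hV, h⟩ := hd ε hε (e x)
    exact ⟨e ⁻¹' V, he.continuousAt hV, fun y hy => h _ hy⟩

/-- Recording a continuous parameter in the value turns a condition on `z ∈ Φ y` that varies with
`y`, such as `dist z (φ y) < η y`, into membership in one fixed open set. -/
theorem LowerHemicontinuous.singleton_prod {Y C Z : Type*} [TopologicalSpace Y]
    [TopologicalSpace C] [TopologicalSpace Z] {Φ : Y → Set Z} (hΦ : LowerHemicontinuous Φ)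
    {c : Y → C} (hc : Continuous c) : LowerHemicontinuous fun y => {c y} ×ˢ Φ y := by
  rw [lowerHemicontinuous_iff_isOpen_inter_nonempty] at hΦ ⊢
  intro u hu
  rw [isOpen_iff_mem_nhds]
  rintro y ⟨⟨c', z⟩, ⟨hc', hz⟩, hyz⟩
  obtain rfl : c' = c y := hc'
  obtain ⟨U, V, hU, hV, hcU, hzV, hUV⟩ := isOpen_prod_iff.1 hu _ _ hyz
  filter_upwards [hc.continuousAt (hU.mem_nhds hcU), (hΦ V hV).mem_nhds ⟨z, hz, hzV⟩]
  rintro y' hy' ⟨z', hz', hzV'⟩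
  exact ⟨(c y', z'), ⟨rfl, hz'⟩, hUV ⟨hy', hzV'⟩⟩

theorem ProximalContinuous.singleton_prod {Y C Z : Type*} [TopologicalSpace Y] [MetricSpace C]
    [TopologicalSpace Z] {Φ : Y → Set Z} (hΦ : ProximalContinuous Φ) {c : Y → C}
    (hc : Continuous c) : ProximalContinuous fun y => {c y} ×ˢ Φ y := by
  refine ⟨hΦ.1.singleton_prod hc, ?_⟩
  obtain ⟨-, d, rfl, hd⟩ := hΦ
  refine ⟨inferInstance, rfl, ?_⟩
  intro ε hε y
  obtain ⟨V, hV, h⟩ := hd ε hε y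
  refine ⟨V ∩ c ⁻¹' Metric.ball (c y) ε,
    Filter.inter_mem hV (hc.continuousAt (Metric.ball_mem_nhds _ hε)), ?_⟩
  rintro y' ⟨hy', hc'⟩ ⟨a, z⟩ ⟨ha, hz⟩
  obtain rfl : a = c y' := ha
  obtain ⟨z', hz', hd'⟩ := Metric.mem_thickening_iff.1 (h y' hy' hz)
  exact Metric.mem_thickening_iff.2 ⟨(c y, z'), ⟨rfl, hz'⟩, max_lt hc' hd'⟩

/-! ### Continuous selections of proximal continuous mappings -/

/-- The cover is indexed by vectors, so its partition of unity averages the indices themselves; only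
`v` whose `W v` meets `Θ y` contribute at `y`, and convexity keeps the average in `T y`. -/
theorem ProximalContinuous.exists_continuous_of_cover {Y Z E : Type*} [TopologicalSpace Y]
    [TopologicalSpace Z] [NormedAddCommGroup E] [NormedSpace ℝ E] {Θ : Y → Set Z}
    (hΘ : ProximalContinuous Θ) (W : E → Set Z) (hW : ∀ v, IsOpen (W v))
    (hcov : ∀ y, ∃ v, (Θ y ∩ W v).Nonempty) (T : Y → Set E) (hT : ∀ y, Convex ℝ (T y))
    (hWT : ∀ y v, (Θ y ∩ W v).Nonempty → v ∈ T y) :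
    ∃ f : Y → E, Continuous f ∧ ∀ y, f y ∈ T y := by
  obtain ⟨p, pc, p0, plf, psum, pW⟩ := hΘ.exists_partition W hW hcov
  refine ⟨fun y => ∑ᶠ i, p i y • i.2, ?_, ?_⟩
  · exact continuous_finsum (fun i => (pc i).smul continuous_const)
      (plf.subset fun i => Function.support_smul_subset_left _ _)
  · exact fun y => (hT y).finsum_mem (fun i => p0 i y) (psum y) fun i hi => hWT y _ (pW i y hi)

/-- Vectors within `η y / 2` of a point of `Φ y ∩ ball (φ y) (η y)` are averaged. They lie in two
convex sets, the thickening of `Φ y` by `η y / 2` and the ball of radius `η y + η y / 2` about `φ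
y`. -/
theorem ProximalContinuous.exists_improved_approximation {Y E : Type*} [TopologicalSpace Y]
    [NormedAddCommGroup E] [NormedSpace ℝ E] {Φ : Y → Set E} (hΦ : ProximalContinuous Φ)
    (hconvex : ∀ y, Convex ℝ (Φ y)) {φ : Y → E} {η : Y → ℝ} (hφ : Continuous φ)
    (hη : Continuous η) (h : ∀ y, (Φ y ∩ Metric.ball (φ y) (η y)).Nonempty) :
    ∃ f : Y → E, Continuous f ∧ (∀ y, (Φ y ∩ Metric.ball (f y) (η y / 2)).Nonempty) ∧
      ∀ y, dist (f y) (φ y) < 3 / 2 * η y := by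
  have hcov : ∀ y, ∃ v : E, (({(φ y, η y)} ×ˢ Φ y) ∩
      {q : (E × ℝ) × E | dist q.2 q.1.1 < q.1.2 ∧ dist q.2 v < q.1.2 / 2}).Nonempty := by
    intro y
    obtain ⟨z, hz, hd⟩ := h y
    have : 0 < η y := dist_nonneg.trans_lt hd
    exact ⟨z, ((φ y, η y), z), ⟨rfl, hz⟩, hd, by simpa using this⟩
  obtain ⟨f, hf, hfT⟩ := (hΦ.singleton_prod (hφ.prodMk hη)).exists_continuous_of_cover
    (fun v : E => {q : (E × ℝ) × E | dist q.2 q.1.1 < q.1.2 ∧ dist q.2 v < q.1.2 / 2})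
    (fun v => (isOpen_lt (by fun_prop) (by fun_prop)).and (isOpen_lt (by fun_prop) (by fun_prop)))
    hcov
    (fun y => Metric.thickening (η y / 2) (Φ y) ∩ Metric.ball (φ y) (3 / 2 * η y))
    (fun y => ((hconvex y).thickening _).inter (convex_ball _ _))
    (by
      rintro y v ⟨⟨_, z⟩, ⟨rfl, hz⟩, hd1, hd2⟩
      change dist z (φ y) < η y at hd1
      change dist z v < η y / 2 at hd2
      refine ⟨Metric.mem_thickening_iff.2 ⟨z, hz, by rwa [dist_comm]⟩, ?_⟩
      rw [Metric.mem_ball]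
      linarith [dist_triangle_left v (φ y) z])
  refine ⟨f, hf, fun y => ?_, fun y => (hfT y).2⟩
  obtain ⟨z, hz, hd⟩ := Metric.mem_thickening_iff.1 (hfT y).1
  exact ⟨z, hz, by rwa [Metric.mem_ball']⟩

/-- A proximal continuous mapping with closed convex values in a Banach space has a continuous
selection near every continuous approximate selection, on any space. -/
theorem ProximalContinuous.exists_selection_near {Y E : Type*} [TopologicalSpace Y]
    [NormedAddCommGroup E] [NormedSpace ℝ E] [CompleteSpace E] {Φ : Y → Set E}
    (hΦ : ProximalContinuous Φ) (hclosed : ∀ y, IsClosed (Φ y)) (hconvex : ∀ y, Convex ℝ (Φ y))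
    {φ : Y → E} {η : Y → ℝ} (hφ : Continuous φ) (hη : Continuous η)
    (h : ∀ y, (Φ y ∩ Metric.ball (φ y) (η y)).Nonempty) :
    ∃ f : Y → E, Continuous f ∧ (∀ y, f y ∈ Φ y) ∧ ∀ y, dist (φ y) (f y) ≤ 3 * η y := by
  have hηpos : ∀ y, 0 < η y := fun y => by
    obtain ⟨z, hz, hd⟩ := h y
    exact dist_nonneg.trans_lt hd
  have step : ∀ n : ℕ, ∀ φ : {φ : Y → E // Continuous φ ∧
      ∀ y, (Φ y ∩ Metric.ball (φ y) (η y / 2 ^ n)).Nonempty}, ∃ f : {φ : Y → E // Continuous φ ∧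
      ∀ y, (Φ y ∩ Metric.ball (φ y) (η y / 2 ^ (n + 1))).Nonempty},
      ∀ y, dist (f.1 y) (φ.1 y) < 3 / 2 * (η y / 2 ^ n) := by
    rintro n ⟨φ, hφ, hd⟩
    obtain ⟨f, hf, hfd, hfφ⟩ := hΦ.exists_improved_approximation hconvex hφ
      (η := fun y => η y / 2 ^ n) (by fun_prop) hd
    refine ⟨⟨f, hf, fun y => ?_⟩, hfφ⟩
    rw [pow_succ, ← div_div]
    exact hfd y
  choose next hnext using step
  let seq : ∀ n : ℕ, {φ : Y → E // Continuous φ ∧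
      ∀ y, (Φ y ∩ Metric.ball (φ y) (η y / 2 ^ n)).Nonempty} := fun n =>
    Nat.rec ⟨φ, hφ, by simpa using h⟩ next n
  have hseq : ∀ y n, dist ((seq n).1 y) ((seq (n + 1)).1 y) ≤ (3 * η y) / 2 / 2 ^ n := by
    intro y n
    rw [dist_comm]
    refine (hnext n (seq n) y).le.trans_eq ?_
    ring
  choose f hf using fun y => cauchySeq_tendsto_of_complete (cauchySeq_of_le_geometric_two (hseq y))
  have hdist : ∀ y n, dist ((seq n).1 y) (f y) ≤ 3 * η y / 2 ^ n := fun y n =>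
    dist_le_of_le_geometric_two_of_tendsto (hseq y) (hf y) n
  have hpow : ∀ a : ℝ, Filter.Tendsto (fun n : ℕ => a / 2 ^ n) Filter.atTop (𝓝 0) := fun a =>
    tendsto_const_nhds.div_atTop (tendsto_pow_atTop_atTop_of_one_lt one_lt_two)
  refine ⟨f, ?_, ?_, fun y => by simpa [seq] using hdist y 0⟩
  · have : TendstoLocallyUniformly (fun n y => (seq n).1 y) f Filter.atTop := by
      rw [Metric.tendstoLocallyUniformly_iff]
      intro ε hε y
      -- As `η` may be unbounded, convergence is uniform only locally, where `η` stays below a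
      -- constant.
      refine ⟨{x | η x < η y + 1}, (isOpen_lt hη continuous_const).mem_nhds (by simp), ?_⟩
      filter_upwards [(hpow (3 * (η y + 1))).eventually_lt_const hε] with n hn x hx
      rw [dist_comm]
      refine ((hdist x n).trans ?_).trans_lt hn
      have := le_of_lt hx
      gcongr
    exact this.continuous (Filter.Frequently.of_forall fun n => (seq n).2.1)
  · intro y
    rw [← (hclosed y).closure_eq, Metric.mem_closure_iff]
    intro ε hε
    obtain ⟨n, hn⟩ := ((hpow (4 * η y)).eventually_lt_const hε).exists
    obtain ⟨z, hz, hd⟩ := (seq n).2.2 y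
    refine ⟨z, hz, ?_⟩
    rw [Metric.mem_ball'] at hd
    have : 4 * η y / 2 ^ n = 3 * η y / 2 ^ n + η y / 2 ^ n := by ring
    linarith [dist_triangle_left (f y) z ((seq n).1 y), hdist y n]

theorem ProximalContinuous.exists_selection {Y E : Type*} [TopologicalSpace Y]
    [NormedAddCommGroup E] [NormedSpace ℝ E] [CompleteSpace E] {Φ : Y → Set E}
    (hΦ : ProximalContinuous Φ) (hne : ∀ y, (Φ y).Nonempty) (hclosed : ∀ y, IsClosed (Φ y))
    (hconvex : ∀ y, Convex ℝ (Φ y)) : ∃ f : Y → E, Continuous f ∧ ∀ y, f y ∈ Φ y := by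
  obtain ⟨φ, hφ, h⟩ := hΦ.exists_continuous_of_cover (fun v : E => Metric.ball v 1)
    (fun v => Metric.isOpen_ball)
    (fun y => (hne y).imp fun z hz => ⟨z, hz, Metric.mem_ball_self one_pos⟩)
    (fun y => Metric.thickening 1 (Φ y)) (fun y => (hconvex y).thickening _)
    (by
      rintro y v ⟨z, hz, hzv⟩
      exact Metric.mem_thickening_iff.2 ⟨z, hz, by rwa [dist_comm]⟩)
  obtain ⟨f, hf, hfΦ, -⟩ := hΦ.exists_selection_near hclosed hconvex hφ
    (continuous_const (y := (1 : ℝ))) fun y => by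
      obtain ⟨z, hz, hd⟩ := Metric.mem_thickening_iff.1 (h y)
      exact ⟨z, hz, by rwa [Metric.mem_ball']⟩
  exact ⟨f, hf, hfΦ⟩

/-! ### Collectionwise normality and Dowker's extension theorem -/

theorem CollectionwiseNormal.exists_expansion {X ι : Type*} [TopologicalSpace X]
    (hX : CollectionwiseNormal X) {D : ι → Set X} (hD : IsDiscreteFamily D) :
    ∃ U : ι → Set X, (∀ i, IsOpen (U i)) ∧ (∀ i, D i ⊆ U i) ∧ IsDiscreteFamily U := by
  obtain ⟨U, hUo, hDU, hUd⟩ := hX (Set.range D) (by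
    intro x
    obtain ⟨N, hN, h⟩ := hD x
    refine ⟨N, hN, ?_⟩
    rintro ⟨_, i, rfl⟩ hi ⟨_, j, rfl⟩ hj
    exact Subtype.ext (congrArg D (h hi hj)))
  -- In a discrete indexed family only the empty set can repeat, so empty members are expanded to
  -- the empty set.
  refine ⟨fun i => {x | (D i).Nonempty ∧ x ∈ U ⟨D i, i, rfl⟩}, fun i => ?_, fun i x hx => ?_, ?_⟩
  · exact isOpen_const.and (hUo _)
  · exact ⟨⟨x, hx⟩, hDU _ hx⟩
  · intro x
    obtain ⟨N, hN, h⟩ := hUd x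
    refine ⟨N, hN, ?_⟩
    rintro i ⟨y, ⟨⟨z, hz⟩, hy⟩, hyN⟩ j ⟨y', ⟨-, hy'⟩, hyN'⟩
    have := h (show _ ∈ _ from ⟨y, hy, hyN⟩) (show _ ∈ _ from ⟨y', hy', hyN'⟩)
    have hij : D i = D j := congrArg Subtype.val this
    exact hD.subsingleton z hz (show z ∈ D j from hij ▸ hz)

theorem CollectionwiseNormal.normalSpace {X : Type*} [TopologicalSpace X]
    (hX : CollectionwiseNormal X) : NormalSpace X := by
  refine ⟨fun C D hC hD hCD => ?_⟩
  obtain ⟨U, hUo, hU, hUd⟩ := hX.exists_expansion (D := fun b : Bool => cond b C D) (by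
    intro x
    by_cases hx : x ∈ C
    · refine ⟨Dᶜ, hD.isOpen_compl.mem_nhds (Set.disjoint_left.1 hCD hx), ?_⟩
      have key : ∀ b ∈ {b : Bool | ((cond b C D) ∩ Dᶜ).Nonempty}, b = true := by
        rintro (_ | _) ⟨y, hy, hy'⟩
        · exact absurd hy hy'
        · rfl
      exact fun a ha b hb => (key a ha).trans (key b hb).symm
    · refine ⟨Cᶜ, hC.isOpen_compl.mem_nhds hx, ?_⟩
      have key : ∀ b ∈ {b : Bool | ((cond b C D) ∩ Cᶜ).Nonempty}, b = false := by
        rintro (_ | _) ⟨y, hy, hy'⟩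
        · rfl
        · exact absurd hy hy'
      exact fun a ha b hb => (key a ha).trans (key b hb).symm)
  refine ⟨U true, U false, hUo _, hUo _, hU true, hU false, Set.disjoint_left.2 fun x h1 h2 => ?_⟩
  exact Bool.noConfusion (hUd.subsingleton x h1 h2)

theorem IsDiscreteFamily.closure_image {X ι : Type*} [TopologicalSpace X] {A : Set X}
    (hA : IsClosed A) {s : ι → Set A} (hs : IsDiscreteFamily s) :
    IsDiscreteFamily fun i => closure ((↑) '' s i : Set X) := by
  have open_nhds : ∀ x : X, ∃ N, IsOpen N ∧ x ∈ N ∧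
      {i | (((↑) '' s i : Set X) ∩ N).Nonempty}.Subsingleton := by
    intro x
    by_cases hx : x ∈ A
    · obtain ⟨N, hN, h⟩ := hs ⟨x, hx⟩
      obtain ⟨M, hMN, hM, hxM⟩ := mem_nhds_iff.1 hN
      obtain ⟨O, hO, rfl⟩ := isOpen_induced_iff.1 hM
      refine ⟨O, hO, hxM, h.anti ?_⟩
      rintro i ⟨_, ⟨a, ha, rfl⟩, haO⟩
      exact ⟨a, ha, hMN haO⟩
    · refine ⟨Aᶜ, hA.isOpen_compl, hx, ?_⟩
      rintro i ⟨_, ⟨a, ha, rfl⟩, haA⟩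
      exact absurd a.2 haA
  intro x
  obtain ⟨N, hN, hxN, h⟩ := open_nhds x
  refine ⟨N, hN.mem_nhds hxN, h.anti ?_⟩
  rintro i ⟨y, hy, hyN⟩
  obtain ⟨z, hzN, hz⟩ := mem_closure_iff.1 hy N hN hyN
  exact ⟨z, hz, hzN⟩

/-- In a collectionwise normal space, a family of functions with discrete supports on a closed
subset extends to a family of functions with discrete supports. -/
theorem CollectionwiseNormal.exists_extension_of_discrete {X ι : Type*} [TopologicalSpace X]
    (hX : CollectionwiseNormal X) {A : Set X} (hA : IsClosed A) {k : ι → A → ℝ}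
    (kc : ∀ i, Continuous (k i)) (k0 : ∀ i a, 0 ≤ k i a) (k1 : ∀ i a, k i a ≤ 1)
    (kd : IsDiscreteFamily fun i => Function.support (k i)) :
    ∃ K : ι → X → ℝ, (∀ i, Continuous (K i)) ∧ (∀ i x, 0 ≤ K i x) ∧ (∀ i x, K i x ≤ 1) ∧
      (IsDiscreteFamily fun i => Function.support (K i)) ∧ ∀ i (a : A), K i a = k i a := by
  have := hX.normalSpace
  obtain ⟨U, hUo, hDU, hUd⟩ := hX.exists_expansion (kd.closure_image hA)
  have hext : ∀ i, ∃ K : X → ℝ, Continuous K ∧ (∀ x, 0 ≤ K x) ∧ (∀ x, K x ≤ 1) ∧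
      Function.support K ⊆ U i ∧ ∀ a : A, K a = k i a := by
    intro i
    obtain ⟨F, hF, hFk⟩ := ContinuousMap.exists_restrict_eq_forall_mem_of_closed
      (⟨k i, kc i⟩ : C(A, ℝ)) (t := Set.Icc 0 1) (fun a => ⟨k0 i a, k1 i a⟩) ⟨0, by simp⟩ hA
    obtain ⟨u, hu0, hu1, hu⟩ := exists_continuous_zero_one_of_isClosed (hUo i).isClosed_compl
      isClosed_closure (Set.disjoint_left.2 fun x hx hx' => hx (hDU i hx'))
    -- The Tietze extension is cut off by a Urysohn function equal to 1 on the closed support and 0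
    -- off `U i`.
    refine ⟨fun x => F x * u x, by fun_prop, fun x => mul_nonneg (hF x).1 (hu x).1,
      fun x => mul_le_one₀ (hF x).2 (hu x).1 (hu x).2, fun x hx => ?_, fun a => ?_⟩
    · by_contra hxU
      exact hx (by simp [hu0 hxU])
    · have hFa : F a = k i a := congrArg (fun G : C(A, ℝ) => G a) hFk
      simp only [hFa]
      by_cases ha : k i a = 0
      · simp [ha]
      · rw [hu1 (subset_closure ⟨a, ha, rfl⟩)]
        simp
  choose K Kc K0 K1 KU Kk using hext
  refine ⟨K, Kc, K0, K1, fun x => ?_, Kk⟩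
  obtain ⟨N, hN, h⟩ := hUd x
  exact ⟨N, hN, h.anti fun i hi => hi.mono (Set.inter_subset_inter_left _ (KU i))⟩

/-- Suprema of the bumps `max 0 (ε - dist (g b) ·)` are 1-Lipschitz on `E`, hence continuous after
composition with `g`, whatever the space `Y`. -/
theorem exists_sigmaDiscrete_approximation {Y E : Type*} [TopologicalSpace Y]
    [PseudoMetricSpace E] {g : Y → E} (hg : Continuous g) {ε : ℝ} (hε : 0 < ε) (hε1 : ε ≤ 1) :
    ∃ k : ℕ → Y → Y → ℝ, (∀ n b, Continuous (k n b)) ∧ (∀ n b y, 0 ≤ k n b y) ∧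
      (∀ n b y, k n b y ≤ 1) ∧ (∀ n, IsDiscreteFamily fun b => Function.support (k n b)) ∧
      (∀ n b y, k n b y ≠ 0 → dist (g b) (g y) < ε) ∧ ∀ y, ∃ n b, 0 < k n b y := by
  have h1 : ∀ b y, max 0 (ε - dist (g b) (g y)) ≤ 1 := fun b y =>
    max_le zero_le_one (by linarith [dist_nonneg (x := g b) (y := g y)])
  obtain ⟨k, kc, k0, k1, kd, kf, kpos⟩ := exists_sigmaDiscrete_refinement
    (fun b y : Y => max 0 (ε - dist (g b) (g y))) h1 (fun J => by
      have hlip : LipschitzWith 1 fun z : E => ⨆ b : J, max 0 (ε - dist (g b) z) := by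
        refine LipschitzWith.of_le_add fun z z' => ?_
        have h0 : 0 ≤ ⨆ b : J, max 0 (ε - dist (g b) z') :=
          Real.iSup_nonneg fun b => le_max_left _ _
        refine Real.iSup_le (fun b => ?_) (add_nonneg h0 dist_nonneg)
        have hb : max 0 (ε - dist (g b) z') ≤ ⨆ b : J, max 0 (ε - dist (g b) z') :=
          le_ciSup (f := fun b : J => max 0 (ε - dist (g b) z')) ⟨1, by
            rintro _ ⟨c, rfl⟩
            exact max_le zero_le_one (by linarith [dist_nonneg (x := g c) (y := z')])⟩ b
        refine max_le (add_nonneg h0 dist_nonneg) ?_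
        linarith [le_max_right 0 (ε - dist (g b) z'), dist_triangle (g b) z z']
      exact hlip.continuous.comp hg) (fun y => ⟨y, by simpa using hε⟩)
  refine ⟨k, kc, k0, k1, kd, fun n b y h => ?_, kpos⟩
  have := kf n b y h
  rw [lt_max_iff] at this
  rcases this with h | h
  · exact absurd h (lt_irrefl 0)
  · linarith

/-- A map into the closed unit ball, on a closed subset of a collectionwise normal space, is
uniformly approximated by the restriction of a globally defined one. -/
theorem CollectionwiseNormal.exists_approximate_extension {X E : Type*} [TopologicalSpace X]
    [NormedAddCommGroup E] [NormedSpace ℝ E] [CompleteSpace E] (hX : CollectionwiseNormal X)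
    {A : Set X} (hA : IsClosed A) {g : A → E} (hg : Continuous g) (hg1 : ∀ a, ‖g a‖ ≤ 1) :
    ∃ G : X → E, Continuous G ∧ (∀ x, ‖G x‖ ≤ 1) ∧ ∀ a : A, ‖g a - G a‖ ≤ 1 / 2 := by
  have := hX.normalSpace
  rcases isEmpty_or_nonempty A with hAe | hAne
  · exact ⟨fun _ => 0, continuous_const, fun _ => by simp, fun a => isEmptyElim a⟩
  obtain ⟨k, kc, k0, k1, kd, kg, kpos⟩ :=
    exists_sigmaDiscrete_approximation hg (by norm_num : (0 : ℝ) < 1 / 2) (by norm_num)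
  choose K Kc K0 K1 Kd Kk using fun n =>
    hX.exists_extension_of_discrete hA (kc n) (k0 n) (k1 n) (kd n)
  -- By discreteness each level sees at most one center `b` at `x`, so the sums defining `s n` and
  -- `N n` reduce to one term.
  have hsingle : ∀ n x, ∃ b₀, ∀ b ≠ b₀, K n b x = 0 := by
    intro n x
    by_cases h : ∃ b, K n b x ≠ 0
    · obtain ⟨b₀, hb₀⟩ := h
      refine ⟨b₀, fun b hb => ?_⟩
      by_contra hne
      exact hb ((Kd n).subsingleton x hne hb₀)
    · push Not at h
      exact ⟨hAne.some, fun b _ => h b⟩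
  choose β hβ using hsingle
  set s : ℕ → X → ℝ := fun n x => ∑ᶠ b, K n b x with hs
  set N : ℕ → X → E := fun n x => ∑ᶠ b, K n b x • g b with hN
  have s_eq : ∀ n x, s n x = K n (β n x) x := fun n x => finsum_eq_single _ _ (hβ n x)
  have N_eq : ∀ n x, N n x = s n x • g (β n x) := fun n x => by
    rw [s_eq]
    exact finsum_eq_single _ _ fun b hb => by rw [hβ n x b hb, zero_smul]
  have sc : ∀ n, Continuous (s n) := fun n => continuous_finsum (Kc n) (Kd n).locallyFinite
  have Nc : ∀ n, Continuous (N n) := fun n =>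
    continuous_finsum (fun b => (Kc n b).smul continuous_const)
      ((Kd n).locallyFinite.subset fun i => Function.support_smul_subset_left _ _)
  have s0 : ∀ n x, 0 ≤ s n x := fun n x => by rw [s_eq]; exact K0 _ _ _
  have s1 : ∀ n x, s n x ≤ 1 := fun n x => by rw [s_eq]; exact K1 _ _ _
  have hNs : ∀ n x, ‖N n x‖ ≤ s n x := fun n x => by
    rw [N_eq, norm_smul, Real.norm_of_nonneg (s0 n x)]
    exact mul_le_of_le_one_right (s0 n x) (hg1 _)
  have hNg : ∀ n (a : A), ‖s n a • g a - N n a‖ ≤ 1 / 2 * s n a := fun n a => by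
    rw [N_eq, ← smul_sub, norm_smul, Real.norm_of_nonneg (s0 n a), mul_comm]
    by_cases h : s n a = 0
    · simp [h]
    · refine mul_le_mul_of_nonneg_right ?_ (s0 n a)
      rw [s_eq, Kk] at h
      have := kg n _ a h
      rw [← dist_eq_norm, dist_comm]
      exact this.le
  have hsum : Summable fun n : ℕ => (1 / 2 : ℝ) ^ n := summable_geometric_two
  have hsle : ∀ n x, (1 / 2 : ℝ) ^ n * s n x ≤ (1 / 2) ^ n := fun n x =>
    mul_le_of_le_one_right (by positivity) (s1 n x)
  have hpos : ∀ n x, 0 ≤ (1 / 2 : ℝ) ^ n * s n x := fun n x => mul_nonneg (by positivity) (s0 n x)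
  have hNle : ∀ n x, ‖(1 / 2 : ℝ) ^ n • N n x‖ ≤ (1 / 2 : ℝ) ^ n * s n x := fun n x => by
    rw [norm_smul, Real.norm_of_nonneg (by positivity)]
    exact mul_le_mul_of_nonneg_left (hNs n x) (by positivity)
  have hsS : ∀ x, Summable fun n => (1 / 2 : ℝ) ^ n * s n x := fun x =>
    Summable.of_nonneg_of_le (fun n => hpos n x) (fun n => hsle n x) hsum
  have hsN : ∀ x, Summable fun n => (1 / 2 : ℝ) ^ n • N n x := fun x =>
    Summable.of_norm_bounded (hsS x) fun n => hNle n x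
  set S : X → ℝ := fun x => ∑' n, (1 / 2 : ℝ) ^ n * s n x with hS
  set M : X → E := fun x => ∑' n, (1 / 2 : ℝ) ^ n • N n x with hM
  have Sc : Continuous S := continuous_tsum (fun n => continuous_const.mul (sc n)) hsum
    fun n x => by rw [Real.norm_of_nonneg (hpos n x)]; exact hsle n x
  have Mc : Continuous M := continuous_tsum (fun n => continuous_const.smul (Nc n)) hsum
    fun n x => (hNle n x).trans (hsle n x)
  have S0 : ∀ x, 0 ≤ S x := fun x => tsum_nonneg fun n => hpos n x
  have hMS : ∀ x, ‖M x‖ ≤ S x := fun x => tsum_of_norm_bounded (hsS x).hasSum fun n => hNle n x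
  have hMg : ∀ a : A, ‖S a • g a - M a‖ ≤ 1 / 2 * S a := by
    intro a
    rw [hS, hM]
    simp only
    rw [← (hsS a).tsum_smul_const, ← ((hsS a).smul_const _).tsum_sub (hsN a), ← tsum_mul_left]
    refine tsum_of_norm_bounded ((hsS a).mul_left _).hasSum fun n => ?_
    rw [mul_smul, ← smul_sub, norm_smul, Real.norm_of_nonneg (by positivity), mul_left_comm]
    exact mul_le_mul_of_nonneg_left (hNg n a) (by positivity)
  have Spos : ∀ a : A, 0 < S a := by
    intro a
    obtain ⟨n, b, h⟩ := kpos a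
    refine (hsS a).tsum_pos (fun n => hpos n a) n (mul_pos (by positivity) ?_)
    refine lt_of_le_of_ne (s0 n a) fun h0 => ?_
    have hb : b = β n a := by
      by_contra hne
      have := hβ n a b hne
      rw [Kk] at this
      exact h.ne' this
    rw [s_eq, ← hb, Kk] at h0
    exact h.ne h0
  -- The average `M / S` breaks down where `S = 0`. Adding `1 - φ` keeps the denominator positive
  -- everywhere without changing it on `A`.
  obtain ⟨φ, hφ0, hφ1, hφ⟩ := exists_continuous_zero_one_of_isClosed
    (isClosed_singleton.preimage Sc : IsClosed (S ⁻¹' {0})) hA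
    (Set.disjoint_left.2 fun x hx hxA => (Spos ⟨x, hxA⟩).ne' hx)
  have hden : ∀ x, 0 < S x + (1 - φ x) := by
    intro x
    rcases (S0 x).eq_or_lt with h | h
    · rw [hφ0 (show S x = 0 from h.symm), ← h]
      simp
    · linarith [(hφ x).2]
  refine ⟨fun x => (S x + (1 - φ x))⁻¹ • M x, ?_, fun x => ?_, fun a => ?_⟩
  · exact ((Sc.add (continuous_const.sub φ.continuous)).inv₀ fun x => (hden x).ne').smul Mc
  · rw [norm_smul, Real.norm_of_nonneg (inv_nonneg.2 (hden x).le), inv_mul_le_one₀ (hden x)]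
    linarith [hMS x, (hφ x).2]
  · simp only [hφ1 a.2, Pi.one_apply, sub_self, add_zero]
    have h : g a - (S a)⁻¹ • M a = (S a)⁻¹ • (S a • g a - M a) := by
      rw [smul_sub, inv_smul_smul₀ (Spos a).ne']
    rw [h, norm_smul, Real.norm_of_nonneg (inv_nonneg.2 (S0 _)), inv_mul_le_iff₀ (Spos a)]
    linarith [hMg a]

/-- Twice the error of an approximate extension again lies in the unit ball, so the approximation
iterates and the corrections with weights `(1/2)^n` telescope to `g` on `A`. -/
theorem CollectionwiseNormal.exists_extension_of_norm_le_one {X E : Type*} [TopologicalSpace X]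
    [NormedAddCommGroup E] [NormedSpace ℝ E] [CompleteSpace E] (hX : CollectionwiseNormal X)
    {A : Set X} (hA : IsClosed A) {g : A → E} (hg : Continuous g) (hg1 : ∀ a, ‖g a‖ ≤ 1) :
    ∃ G : X → E, Continuous G ∧ ∀ a : A, G a = g a := by
  choose G Gc G1 Gg using fun g : {g : A → E // Continuous g ∧ ∀ a, ‖g a‖ ≤ 1} =>
    hX.exists_approximate_extension hA g.2.1 g.2.2
  let next : {g : A → E // Continuous g ∧ ∀ a, ‖g a‖ ≤ 1} →
      {g : A → E // Continuous g ∧ ∀ a, ‖g a‖ ≤ 1} := fun g =>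
    ⟨fun a => (2 : ℝ) • (g.1 a - G g a),
      continuous_const.smul (g.2.1.sub ((Gc g).comp continuous_subtype_val)), fun a => by
        rw [norm_smul, Real.norm_two]
        linarith [Gg g a]⟩
  let r : ℕ → {g : A → E // Continuous g ∧ ∀ a, ‖g a‖ ≤ 1} := fun n => next^[n] ⟨g, hg, hg1⟩
  have hr : ∀ n (a : A), (r (n + 1)).1 a = (2 : ℝ) • ((r n).1 a - G (r n) a) := fun n a => by
    simp only [r, Function.iterate_succ_apply', next]
  have hbound : ∀ n x, ‖(1 / 2 : ℝ) ^ n • G (r n) x‖ ≤ (1 / 2) ^ n := fun n x => by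
    rw [norm_smul, Real.norm_of_nonneg (by positivity)]
    exact mul_le_of_le_one_right (by positivity) (G1 _ _)
  refine ⟨fun x => ∑' n, (1 / 2 : ℝ) ^ n • G (r n) x,
    continuous_tsum (fun n => continuous_const.smul (Gc _)) summable_geometric_two hbound,
    fun a => ?_⟩
  have hpartial : ∀ n, ∑ i ∈ Finset.range n, (1 / 2 : ℝ) ^ i • G (r i) a =
      g a - (1 / 2 : ℝ) ^ n • (r n).1 a := by
    intro n
    induction n with
    | zero => simp [r]
    | succ n ih =>
      rw [Finset.sum_range_succ, ih, hr, smul_smul, pow_succ, mul_assoc,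
        one_div_mul_cancel two_ne_zero, mul_one, smul_sub]
      abel
  have hsum : Summable fun n => (1 / 2 : ℝ) ^ n • G (r n) a :=
    Summable.of_norm_bounded summable_geometric_two fun n => hbound n a
  refine tendsto_nhds_unique hsum.hasSum.tendsto_sum_nat ?_
  simp only [hpartial]
  have hz : Filter.Tendsto (fun n => (1 / 2 : ℝ) ^ n • (r n).1 a) Filter.atTop (𝓝 0) := by
    refine squeeze_zero_norm (fun n => ?_)
      (tendsto_pow_atTop_nhds_zero_of_lt_one (by norm_num : (0 : ℝ) ≤ 1 / 2) (by norm_num))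
    rw [norm_smul, Real.norm_of_nonneg (by positivity)]
    exact mul_le_of_le_one_right (by positivity) ((r n).2.2 a)
  simpa using tendsto_const_nhds.sub hz

/-- **Dowker's extension theorem**: continuous Banach space valued maps on closed subsets of a
collectionwise normal space extend continuously to the whole space. -/
theorem CollectionwiseNormal.exists_extension {X E : Type*} [TopologicalSpace X]
    [NormedAddCommGroup E] [NormedSpace ℝ E] [CompleteSpace E] (hX : CollectionwiseNormal X)
    {A : Set X} (hA : IsClosed A) {g : A → E} (hg : Continuous g) :
    ∃ G : X → E, Continuous G ∧ ∀ a : A, G a = g a := by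
  have := hX.normalSpace
  have hpos : ∀ a, 0 < 1 + ‖g a‖ := fun a => by positivity
  -- The map `v ↦ v / (1 + ‖v‖)` sends `E` onto the open unit ball, with inverse `w ↦ w / (1 -
  -- ‖w‖)`. The cutoff `φ` below forces the extension back into the open ball.
  have hlt : ∀ a, ‖(1 + ‖g a‖)⁻¹ • g a‖ < 1 := fun a => by
    rw [norm_smul, Real.norm_of_nonneg (inv_nonneg.2 (hpos a).le), inv_mul_lt_one₀ (hpos a)]
    linarith
  obtain ⟨F, hF, hFg⟩ := hX.exists_extension_of_norm_le_one hA
    (g := fun a => (1 + ‖g a‖)⁻¹ • g a)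
    (((continuous_const.add hg.norm).inv₀ fun a => (hpos a).ne').smul hg) fun a => (hlt a).le
  obtain ⟨φ, hφ0, hφ1, hφ⟩ := exists_continuous_zero_one_of_isClosed
    (isClosed_le continuous_const hF.norm : IsClosed {x | 1 ≤ ‖F x‖}) hA
    (Set.disjoint_left.2 fun x (hx : 1 ≤ ‖F x‖) hxA => by
      rw [hFg ⟨x, hxA⟩] at hx
      exact (hlt ⟨x, hxA⟩).not_ge hx)
  have hφF : ∀ x, ‖φ x • F x‖ < 1 := fun x => by
    rcases le_or_gt 1 ‖F x‖ with h | h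
    · rw [hφ0 h]
      simp
    · rw [norm_smul, Real.norm_of_nonneg (hφ x).1]
      exact (mul_le_of_le_one_left (norm_nonneg _) (hφ x).2).trans_lt h
  refine ⟨fun x => (1 - ‖φ x • F x‖)⁻¹ • (φ x • F x), ?_, fun a => ?_⟩
  · have hc : Continuous fun x => φ x • F x := φ.continuous.smul hF
    exact ((continuous_const.sub hc.norm).inv₀ fun x => (sub_pos.2 (hφF x)).ne').smul hc
  · have h : 1 - ‖(1 + ‖g a‖)⁻¹ • g a‖ = (1 + ‖g a‖)⁻¹ := by
      rw [norm_smul, Real.norm_of_nonneg (inv_nonneg.2 (hpos a).le)]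
      field_simp [(hpos a).ne']
      ring
    simp only [hφ1 a.2, Pi.one_apply, one_smul, hFg a]
    rw [h, inv_inv, smul_inv_smul₀ (hpos a).ne']

/-! ### Controlling the distance to `Φ` and gluing -/

/-- If `φ` is a selection of `Φ` on a closed set, then the truncated distance from `φ` to `Φ` is
dominated by a continuous function vanishing on that set. -/
theorem LowerHemicontinuous.exists_continuous_control {X E : Type*} [TopologicalSpace X]
    [NormalSpace X] [MetricSpace E] {Φ : X → Set E} (hΦ : LowerHemicontinuous Φ)
    (hne : ∀ x, (Φ x).Nonempty) {A : Set X} (hA : IsClosed A) {φ : X → E} (hφ : Continuous φ)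
    (hφA : ∀ x ∈ A, φ x ∈ Φ x) :
    ∃ η : X → ℝ, Continuous η ∧ (∀ x, 0 ≤ η x) ∧ (∀ x ∈ A, η x = 0) ∧
      ∀ x, min 1 (Metric.infDist (φ x) (Φ x)) ≤ η x := by
  set U : ℕ → Set X := fun n => {x | Metric.infDist (φ x) (Φ x) < (1 / 2) ^ n} with hU
  have hUo : ∀ n, IsOpen (U n) := by
    intro n
    have h := lowerHemicontinuous_iff_isOpen_inter_nonempty.1 (hΦ.singleton_prod hφ)
      {q : E × E | dist q.1 q.2 < (1 / 2) ^ n} (isOpen_lt (by fun_prop) (by fun_prop))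
    convert h using 1
    ext x
    simp only [hU, Set.mem_ofPred_eq, Metric.infDist_lt_iff (hne x)]
    constructor
    · rintro ⟨z, hz, hd⟩
      exact ⟨(φ x, z), ⟨rfl, hz⟩, hd⟩
    · rintro ⟨⟨_, z⟩, ⟨rfl, hz⟩, hd⟩
      exact ⟨z, hz, hd⟩
  have hAU : ∀ n, A ⊆ U n := fun n x hx => by
    simp only [hU, Set.mem_ofPred_eq, Metric.infDist_zero_of_mem (hφA x hx)]
    positivity
  choose u hu0 hu1 hu using fun n => exists_continuous_zero_one_of_isClosed hA
    (hUo n).isClosed_compl (Set.disjoint_left.2 fun x hx hx' => hx' (hAU n hx))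
  have hle : ∀ n x, (1 / 2 : ℝ) ^ n * u n x ≤ (1 / 2) ^ n := fun n x =>
    mul_le_of_le_one_right (by positivity) (hu n x).2
  have hnn : ∀ n x, 0 ≤ (1 / 2 : ℝ) ^ n * u n x := fun n x => mul_nonneg (by positivity) (hu n x).1
  have hsum : ∀ x, Summable fun n => (1 / 2 : ℝ) ^ n * u n x := fun x =>
    Summable.of_nonneg_of_le (fun n => hnn n x) (fun n => hle n x) summable_geometric_two
  have hη0 : ∀ x, 0 ≤ ∑' n, (1 / 2 : ℝ) ^ n * u n x := fun x => tsum_nonneg fun n => hnn n x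
  -- The factor 2 pays for an index shift: a truncated distance in `((1/2)^(n+1), (1/2)^n]` only
  -- guarantees `u (n + 1) x = 1`.
  refine ⟨fun x => 2 * ∑' n, (1 / 2 : ℝ) ^ n * u n x, ?_, fun x => ?_, fun x hx => ?_, fun x => ?_⟩
  · exact continuous_const.mul (continuous_tsum (fun n => by fun_prop) summable_geometric_two
      fun n x => by rw [Real.norm_of_nonneg (hnn n x)]; exact hle n x)
  · exact mul_nonneg zero_le_two (hη0 x)
  · have : ∀ n, (1 / 2 : ℝ) ^ n * u n x = 0 := fun n => by simp [hu0 n hx]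
    simp only [this, tsum_zero, mul_zero]
  · rcases Metric.infDist_nonneg.eq_or_lt (a := (0 : ℝ)) (b := Metric.infDist (φ x) (Φ x))
      with h | h
    · rw [← h]
      simpa using hη0 x
    obtain ⟨n, hn, hn'⟩ := exists_nat_pow_near_of_lt_one (lt_min one_pos h) (min_le_left _ _)
      (by norm_num : (0 : ℝ) < 1 / 2) (by norm_num)
    have hx : x ∉ U (n + 1) := fun hx => (hn.trans_le (min_le_right _ _)).not_gt hx
    have hterm := (hsum x).le_tsum (n + 1) fun m _ => hnn m x
    rw [hu1 (n + 1) hx, Pi.one_apply, mul_one, pow_succ] at hterm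
    linarith

/-- A map is continuous if it is continuous on a cozero set and is dominated, near the zero set,
by its distance to a continuous map. -/
theorem continuous_of_dist_le_control {X E : Type*} [TopologicalSpace X] [MetricSpace E]
    {f φ : X → E} {η : X → ℝ} {C : ℝ} (hφ : Continuous φ) (hη : Continuous η)
    (hf : ContinuousOn f {x | η x ≠ 0})
    (hd : ∀ x, η x < 1 / 2 → dist (f x) (φ x) ≤ C * η x) : Continuous f := by
  rw [continuous_iff_continuousAt]
  intro x
  by_cases hx : η x = 0
  · have hfx : f x = φ x := by
      have := hd x (by rw [hx]; norm_num)
      rw [hx, mul_zero] at this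
      exact dist_le_zero.1 this
    have h1 : Filter.Tendsto (fun y => C * η y) (𝓝 x) (𝓝 0) := by
      have h : ContinuousAt (fun y => C * η y) x := by fun_prop
      simpa [ContinuousAt, hx] using h
    have h2 : ∀ᶠ y in 𝓝 x, η y < 1 / 2 :=
      hη.continuousAt.eventually_lt_const (by rw [hx]; norm_num)
    have h3 : Filter.Tendsto (fun y => dist (f y) (φ y)) (𝓝 x) (𝓝 0) :=
      squeeze_zero' (Filter.Eventually.of_forall fun y => dist_nonneg)
        (h2.mono fun y hy => hd y hy) h1
    rw [ContinuousAt, hfx]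
    refine hφ.continuousAt.congr_dist ?_
    simpa only [dist_comm] using h3
  · exact hf.continuousAt ((isOpen_ne_fun hη continuous_const).mem_nhds hx)

theorem mainTheorem1 {X : Type*} [TopologicalSpace X] [T2Space X] (hX : CollectionwiseNormal X)
    {E : Type*} [NormedAddCommGroup E] [NormedSpace ℝ E] [CompleteSpace E]
    (Φ : X → Set E) (hne : ∀ x, (Φ x).Nonempty) (hclosed : ∀ x, IsClosed (Φ x))
    (hconvex : ∀ x, Convex ℝ (Φ x)) (hlsc : LowerHemicontinuous Φ)
    (A : Set X) (hA : IsClosed A)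
    (hprox : ProximalContinuous (fun x : (Aᶜ : Set X) => Φ x))
    (g : A → E) (hg : Continuous g) (hgsel : ∀ a : A, g a ∈ Φ a) :
    ∃ f : X → E, Continuous f ∧ (∀ x, f x ∈ Φ x) ∧ ∀ a : A, f a = g a := by
  classical
  have := hX.normalSpace
  obtain ⟨φ, hφ, hφg⟩ := hX.exists_extension hA hg
  obtain ⟨η, hη, η0, ηA, hηle⟩ := hlsc.exists_continuous_control hne hA hφ fun x hx => by
    rw [hφg ⟨x, hx⟩]
    exact hgsel ⟨x, hx⟩
  obtain ⟨h, hh, hhΦ⟩ := hprox.exists_selection (fun x => hne x) (fun x => hclosed x)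
    fun x => hconvex x
  let e : {x // η x ≠ 0} → (Aᶜ : Set X) := fun x => ⟨x, fun hx => x.2 (ηA x hx)⟩
  have he : Continuous e := continuous_subtype_val.subtype_mk _
  -- Where `η ≥ 1` the truncated control says nothing, so the second term enlarges the ball until it
  -- contains the selection `h`. It vanishes for `η ≤ 1/2`, leaving `3 * (2 * η)`, the source of `C
  -- = 6`.
  let M : {x // η x ≠ 0} → ℝ := fun x => 2 * η x + max 0 (2 * η x - 1) * dist (h (e x)) (φ x)
  have hM : Continuous M := by fun_prop
  have hclose : ∀ x : {x // η x ≠ 0}, (Φ x ∩ Metric.ball (φ x) (M x)).Nonempty := by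
    intro x
    have hηx : 0 < η x := lt_of_le_of_ne (η0 x) x.2.symm
    rcases lt_or_ge (η x) 1 with h1 | h1
    · have hdist : Metric.infDist (φ x) (Φ x) ≤ η x :=
        (min_le_iff.1 (hηle x)).resolve_left h1.not_ge
      have hlt : Metric.infDist (φ x) (Φ x) < M x := by
        have : 0 ≤ max 0 (2 * η x - 1) * dist (h (e x)) (φ x) :=
          mul_nonneg (le_max_left _ _) dist_nonneg
        simp only [M]
        linarith
      obtain ⟨z, hz, hd⟩ := (Metric.infDist_lt_iff (hne x)).1 hlt
      exact ⟨z, hz, by rwa [Metric.mem_ball']⟩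
    · refine ⟨h (e x), hhΦ (e x), ?_⟩
      have : 1 * dist (h (e x)) (φ x) ≤ max 0 (2 * η x - 1) * dist (h (e x)) (φ x) :=
        mul_le_mul_of_nonneg_right (le_max_of_le_right (by linarith)) dist_nonneg
      simp only [M, Metric.mem_ball]
      linarith
  obtain ⟨f, hf, hfΦ, hfφ⟩ := (hprox.comp he).exists_selection_near (fun x => hclosed x)
    (fun x => hconvex x) (hφ.comp continuous_subtype_val) hM hclose
  let F : X → E := fun x => if hx : η x ≠ 0 then f ⟨x, hx⟩ else φ x
  have hF : ∀ x : {x // η x ≠ 0}, F x = f x := fun x => dif_pos x.2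
  have hFφ : ∀ x, η x = 0 → F x = φ x := fun x hx => dif_neg (not_not.2 hx)
  refine ⟨F, continuous_of_dist_le_control (C := 6) hφ hη ?_ fun x hx => ?_, fun x => ?_,
    fun a => ?_⟩
  · rw [continuousOn_iff_continuous_domRestrict]
    exact hf.congr fun x => (hF x).symm
  · by_cases h0 : η x = 0
    · rw [hFφ x h0, dist_self, h0, mul_zero]
    · have hd := hfφ ⟨x, h0⟩
      have hmax : max 0 (2 * η x - 1) = 0 := max_eq_left (by linarith)
      simp only [M, hmax, zero_mul, add_zero] at hd
      rw [hF ⟨x, h0⟩, dist_comm]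
      exact hd.trans_eq (by ring)
  · by_cases h0 : η x = 0
    · rw [hFφ x h0, ← (hclosed x).closure_eq, Metric.mem_closure_iff_infDist_zero (hne x)]
      have := hηle x
      rw [h0, min_le_iff] at this
      exact le_antisymm (this.resolve_left (by norm_num)) Metric.infDist_nonneg
    · rw [hF ⟨x, h0⟩]
      exact hfΦ ⟨x, h0⟩
  · rw [hFφ a (ηA a a.2), hφg]
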